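/- Let $X$ be a real Banach space with unit sphere $S_X$, and suppose that the closed unit ball $B_{X^*}$ of its dual is weak*-sequentially compact, i.e. every sequence in $B_{X^*}$ has a subsequence that converges weak* to an element of $B_{X^*}$. Say that $X$ has the fixed point property (FPP) if for every nonempty weakly compact convex set $C \subseteq X$, every nonexpansive map $T : C \to C$ (that is, $\|Tx - Ty\| \le \|x - y\|$ for all $x, y \in C$) has a fixed point. If $X$ does not have the FPP, then the James constant $$J(X) = \sup\{\min(\|x+y\|, \|x-y\|) : x, y \in S_X\}$$ equals $2$. -/

import Mathlib

/-- The set of values `‖x + y‖ ∧ ‖x - y‖` for `x, y` in the unit sphere. -/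
def jamesSet (X : Type*) [NormedAddCommGroup X] : Set ℝ :=
  {r | ∃ x ∈ Metric.sphere (0 : X) 1, ∃ y ∈ Metric.sphere (0 : X) 1,
    r = min ‖x + y‖ ‖x - y‖}

/-- The set defining the James constant is bounded above by `2`, so that its real supremum is
a genuine one as soon as the unit sphere is nonempty. -/
theorem jamesSet_le_two (X : Type*) [NormedAddCommGroup X] : 2 ∈ upperBounds (jamesSet X) := by
  rintro r ⟨x, hx, y, hy, rfl⟩
  have hx' : ‖x‖ = 1 := by simpa using hx
  have hy' : ‖y‖ = 1 := by simpa using hy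
  have h := norm_add_le x y
  exact (min_le_left _ _).trans (by linarith)

/-- The James constant `J(X) = sup {‖x + y‖ ∧ ‖x - y‖ : x, y ∈ S_X}`. -/
noncomputable def jamesConstant (X : Type*) [NormedAddCommGroup X] : ℝ :=
  sSup (jamesSet X)

/-- The fixed point property for nonexpansive maps on weakly compact convex sets: every
nonexpansive self-map of a nonempty weakly compact convex subset of `X` has a fixed point. -/
def HasFPP (X : Type*) [NormedAddCommGroup X] [NormedSpace ℝ X] : Prop :=
  ∀ C : Set X, C.Nonempty → Convex ℝ C → IsCompact (toWeakSpace ℝ X '' C) →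
    ∀ T : C → C, (∀ x y : C, ‖(T x : X) - T y‖ ≤ ‖(x : X) - y‖) → ∃ x : C, T x = x

/-- The closed unit ball (for the dual norm) of the dual of `X`, as a subset of the dual with the
weak-star topology. -/
def weakStarDualBall (X : Type*) [NormedAddCommGroup X] [NormedSpace ℝ X] :
    Set (WeakDual ℝ X) :=
  WeakDual.toStrongDual ⁻¹' Metric.closedBall (0 : StrongDual ℝ X) 1

/-! If the FPP fails, Zorn gives a minimal weakly compact convex invariant set `K` of diameter `d >
0`. Let `x n` be approximate fixed points with weak limit `p`, and let `w n` be fixed by `z ↦ (1 -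
r) T z + r (p + x n) / 2`. Nonexpansiveness puts the `w n` within `d / 2` of one another and,
nearly, of `x n`; so their weak limit `y` is within `d / 2` of `p` and of each `w n`. For small `r`
the Goebel–Karlovitz lemma gives `‖w n - p‖ ≈ d`, so a functional norming `w n - p` is nearly `d /
2` on both `w n - y` and `y - p`. For suitable `n, m` the vectors `w n - w m` and `y - p`, of norm
at most `d / 2`, then have sum and difference of norm nearly `d`. Scaling by `2 / d` gives `J(X) =
2`. -/

open Filter Topology Set

/-! ### Weak and weak-star limits along ultrafilters -/

section WeakTopology

variable {X : Type*} [NormedAddCommGroup X] [NormedSpace ℝ X]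

/-- A set which is compact in the weak topology is norm closed. -/
theorem isClosed_of_isCompact_toWeakSpace {C : Set X} (hC : IsCompact (toWeakSpace ℝ X '' C)) :
    IsClosed C := by
  have h := hC.isClosed.preimage (toWeakSpaceCLM ℝ X).continuous
  have e : (toWeakSpaceCLM ℝ X) ⁻¹' (toWeakSpace ℝ X '' C) = C :=
    Set.preimage_image_eq C (toWeakSpace ℝ X).injective
  rwa [e] at h

/-- A closed convex set is closed in the weak topology. -/
theorem Convex.isClosed_toWeakSpace_image {C : Set X} (hC : Convex ℝ C) (h : IsClosed C) :
    IsClosed (toWeakSpace ℝ X '' C) := by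
  rw [← closure_eq_iff_isClosed, ← hC.toWeakSpace_closure ℝ, h.closure_eq]

theorem continuous_weakSpace_dual (f : StrongDual ℝ X) :
    Continuous fun x : WeakSpace ℝ X => f ((toWeakSpace ℝ X).symm x) :=
  WeakBilin.eval_continuous (topDualPairing ℝ X).flip f

/-- A weakly compact set is bounded. -/
theorem isBounded_of_isCompact_toWeakSpace {C : Set X} (hC : IsCompact (toWeakSpace ℝ X '' C)) :
    Bornology.IsBounded C := by
  have key : ∀ f : StrongDual ℝ X, ∃ M, ∀ x : C,
      ‖NormedSpace.inclusionInDoubleDual ℝ X x f‖ ≤ M := by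
    intro f
    obtain ⟨M, hM⟩ := (hC.image (continuous_weakSpace_dual f)).isBounded.exists_norm_le
    refine ⟨M, fun x => ?_⟩
    have := hM (f x) ⟨toWeakSpace ℝ X x, ⟨x, x.2, rfl⟩, by simp⟩
    simpa using this
  obtain ⟨M, hM⟩ := banach_steinhaus key
  refine isBounded_iff_forall_norm_le.2 ⟨M, fun x hx => ?_⟩
  exact ((NormedSpace.inclusionInDoubleDualLi ℝ).norm_map x).symm.trans_le (hM ⟨x, hx⟩)

/-- Along an ultrafilter, a family in a weakly compact set converges weakly. -/
theorem exists_weak_limit {ι : Type*} {C : Set X} (hC : IsCompact (toWeakSpace ℝ X '' C))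
    (U : Ultrafilter ι) {u : ι → X} (hu : ∀ i, u i ∈ C) :
    ∃ x ∈ C, ∀ f : StrongDual ℝ X, Tendsto (fun i => f (u i)) U (𝓝 (f x)) := by
  obtain ⟨_, ⟨x, hx, rfl⟩, hl⟩ := hC.ultrafilter_le_nhds (U.map fun i => toWeakSpace ℝ X (u i))
    (le_principal_iff.2 (Ultrafilter.mem_map.2
      (Eventually.of_forall fun i => mem_image_of_mem _ (hu i) : ∀ᶠ i in (U : Filter ι), _)))
  refine ⟨x, hx, fun f => ?_⟩
  have h1 : Tendsto (fun i => toWeakSpace ℝ X (u i)) U (𝓝 (toWeakSpace ℝ X x)) := hl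
  have h2 := ((continuous_weakSpace_dual f).tendsto _).comp h1
  simpa [Function.comp_def] using h2

/-- Weak lower semicontinuity of the norm. -/
theorem norm_le_of_weak_tendsto {ι : Type*} {l : Filter ι} [l.NeBot] {u : ι → X} {x : X} {c : ℝ}
    (h : ∀ f : StrongDual ℝ X, Tendsto (fun i => f (u i)) l (𝓝 (f x)))
    (hc : ∀ᶠ i in l, ‖u i‖ ≤ c) : ‖x‖ ≤ c := by
  obtain ⟨f, hf, hfx⟩ := exists_dual_vector'' ℝ x
  have h1 : f x = ‖x‖ := by simpa using hfx
  rw [← h1]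
  refine le_of_tendsto (h f) (hc.mono fun i hi => ?_)
  exact (le_abs_self _).trans ((f.le_of_opNorm_le hf _).trans (by simpa using hi))

/-- Along an ultrafilter, a family in the dual unit ball converges weak-star. -/
theorem exists_weakStar_limit {ι : Type*} (U : Ultrafilter ι) {g : ι → StrongDual ℝ X}
    (hg : ∀ i, ‖g i‖ ≤ 1) :
    ∃ f : StrongDual ℝ X, ∀ x, Tendsto (fun i => g i x) U (𝓝 (f x)) := by
  obtain ⟨F, -, hl⟩ := (WeakDual.isCompact_closedBall (0 : StrongDual ℝ X) 1).ultrafilter_le_nhds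
    (U.map fun i => StrongDual.toWeakDual (g i))
    (le_principal_iff.2 (Ultrafilter.mem_map.2
      (Eventually.of_forall fun i => by simpa using hg i : ∀ᶠ i in (U : Filter ι), _)))
  have h1 : Tendsto (fun i => StrongDual.toWeakDual (g i)) U (𝓝 F) := hl
  exact ⟨WeakDual.toStrongDual F, fun x => ((WeakDual.eval_continuous x).tendsto _).comp h1⟩

end WeakTopology

/-! ### Minimal invariant sets, Goebel–Karlovitz, and the almost square pair -/

section MinimalSets

variable {X : Type*} [NormedAddCommGroup X] [NormedSpace ℝ X]

/-- A nonempty closed convex subset mapped into itself by `T`. -/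
structure IsClosedConvexInvariant (T : X → X) (K : Set X) : Prop where
  nonempty : K.Nonempty
  convex : Convex ℝ K
  isClosed : IsClosed K
  mapsTo : MapsTo T K K

/-- A closed convex `T`-invariant set that is minimal, weakly compact, and on which `T` is
nonexpansive. -/
structure IsMinimalInvariant (T : X → X) (K : Set X) : Prop extends
    IsClosedConvexInvariant T K where
  isCompact : IsCompact (toWeakSpace ℝ X '' K)
  nonexpansive : ∀ x ∈ K, ∀ y ∈ K, ‖T x - T y‖ ≤ ‖x - y‖
  minimal : ∀ A ⊆ K, IsClosedConvexInvariant T A → A = K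

/-- Zorn's lemma: closed convex sets are weakly closed, so weak compactness keeps the intersection
of a chain nonempty. -/
theorem exists_isMinimalInvariant {T : X → X} {C : Set X} (hne : C.Nonempty) (hconv : Convex ℝ C)
    (hC : IsCompact (toWeakSpace ℝ X '' C)) (hT : MapsTo T C C)
    (hlip : ∀ x ∈ C, ∀ y ∈ C, ‖T x - T y‖ ≤ ‖x - y‖) :
    ∃ K ⊆ C, IsMinimalInvariant T K := by
  have hcl := isClosed_of_isCompact_toWeakSpace hC
  obtain ⟨K, hKC, hK⟩ := zorn_superset_nonempty {A | A ⊆ C ∧ IsClosedConvexInvariant T A} (by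
    rintro c hc hchain ⟨A₀, hA₀⟩
    refine ⟨⋂₀ c, ⟨(sInter_subset_of_mem hA₀).trans (hc hA₀).1, ?_, ?_, ?_, ?_⟩,
      fun s hs => sInter_subset_of_mem hs⟩
    · have hwc : ∀ A : c, IsClosed (toWeakSpace ℝ X '' (A : Set X)) := fun A =>
        (hc A.2).2.convex.isClosed_toWeakSpace_image (hc A.2).2.isClosed
      have : Nonempty c := ⟨⟨A₀, hA₀⟩⟩
      obtain ⟨z, hz⟩ := IsCompact.nonempty_iInter_of_directed_nonempty_isCompact_isClosed
        (fun A : c => toWeakSpace ℝ X '' (A : Set X))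
        (fun A B => (hchain.total A.2 B.2).elim (fun h => ⟨A, Subset.rfl, image_mono h⟩)
          fun h => ⟨B, image_mono h, Subset.rfl⟩)
        (fun A => (hc A.2).2.nonempty.image _)
        (fun A => hC.of_isClosed_subset (hwc A) (image_mono (hc A.2).1)) hwc
      refine ⟨(toWeakSpace ℝ X).symm z, fun A hA => ?_⟩
      obtain ⟨x, hx, rfl⟩ := mem_iInter.1 hz ⟨A, hA⟩
      simpa using hx
    · exact convex_sInter fun A hA => (hc hA).2.convex
    · exact isClosed_sInter fun A hA => (hc hA).2.isClosed
    · exact fun x hx A hA => (hc hA).2.mapsTo (hx A hA)) C ⟨Subset.rfl, hne, hconv, hcl, hT⟩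
  refine ⟨K, hKC, hK.prop.2, ?_, fun x hx y hy => hlip x (hKC hx) y (hKC hy), fun A hA h => ?_⟩
  · exact hC.of_isClosed_subset (hK.prop.2.convex.isClosed_toWeakSpace_image hK.prop.2.isClosed)
      (image_mono hKC)
  · exact Subset.antisymm hA (hK.le_of_le ⟨hA.trans hKC, h⟩ hA)

namespace IsMinimalInvariant

variable {T : X → X} {K : Set X}

theorem closedConvexHull_image (h : IsMinimalInvariant T K) :
    closedConvexHull ℝ (T '' K) = K := by
  have hsub : closedConvexHull ℝ (T '' K) ⊆ K :=
    closedConvexHull_min h.mapsTo.image_subset h.convex h.isClosed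
  refine h.minimal _ hsub ⟨(h.nonempty.image T).mono subset_closedConvexHull,
    convex_closedConvexHull, isClosed_closedConvexHull, fun x hx => ?_⟩
  exact subset_closedConvexHull (mem_image_of_mem T (hsub hx))

/-- Minimal sets are diametral: every point has the same radius. -/
theorem norm_sub_le_of_radius (h : IsMinimalInvariant T K) {s : ℝ} {x₀ : X} (hx₀ : x₀ ∈ K)
    (hs : ∀ y ∈ K, ‖y - x₀‖ ≤ s) : ∀ x ∈ K, ∀ y ∈ K, ‖y - x‖ ≤ s := by
  -- Invariance: a ball about `T x` containing `T '' K` contains its closed convex hull, which is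
  -- `K`.
  have hA : K ∩ ⋂ y ∈ K, Metric.closedBall y s = K := by
    refine h.minimal _ inter_subset_left ⟨⟨x₀, hx₀, ?_⟩, ?_, ?_, ?_⟩
    · simpa [dist_eq_norm, norm_sub_rev] using hs
    · exact h.convex.inter (convex_iInter₂ fun y _ => convex_closedBall y s)
    · exact h.isClosed.inter (isClosed_biInter fun y _ => Metric.isClosed_closedBall)
    · rintro x ⟨hx, hxs⟩
      simp only [mem_iInter, Metric.mem_closedBall, dist_eq_norm] at hxs
      have hsub : closedConvexHull ℝ (T '' K) ⊆ Metric.closedBall (T x) s := by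
        refine closedConvexHull_min ?_ (convex_closedBall _ _) Metric.isClosed_closedBall
        rintro _ ⟨y, hy, rfl⟩
        rw [Metric.mem_closedBall, dist_eq_norm, norm_sub_rev]
        exact (h.nonexpansive x hx y hy).trans (hxs y hy)
      rw [h.closedConvexHull_image] at hsub
      refine ⟨h.mapsTo hx, mem_iInter₂.2 fun y hy => ?_⟩
      rw [Metric.mem_closedBall, dist_comm]
      exact hsub hy
  intro x hx y hy
  rw [← hA] at hx
  have := mem_iInter₂.1 hx.2 y hy
  rwa [Metric.mem_closedBall, dist_comm, dist_eq_norm] at this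

/-- The Goebel–Karlovitz lemma along an ultrafilter. -/
theorem norm_sub_le_of_approx_fixed (h : IsMinimalInvariant T K) {ι : Type*} (U : Ultrafilter ι)
    {u : ι → X} (hu : ∀ i, u i ∈ K) (hfix : Tendsto (fun i => ‖T (u i) - u i‖) U (𝓝 0))
    {s : ℝ} {x₀ : X} (hx₀ : x₀ ∈ K) (hs : ∀ᶠ i in (U : Filter ι), ‖u i - x₀‖ ≤ s) :
    ∀ x ∈ K, ∀ y ∈ K, ‖y - x‖ ≤ s := by
  -- The slack `ε` makes this set closed and absorbs the error `‖T (u i) - u i‖`.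
  have hA : {x ∈ K | ∀ ε > 0, ∀ᶠ i in (U : Filter ι), ‖u i - x‖ ≤ s + ε} = K := by
    refine h.minimal _ (sep_subset _ _) ⟨⟨x₀, hx₀, fun ε hε => ?_⟩, ?_, ?_, ?_⟩
    · filter_upwards [hs] with i hi using by linarith
    · rintro x ⟨hx, hxs⟩ y ⟨hy, hys⟩ a b ha hb hab
      refine ⟨h.convex hx hy ha hb hab, fun ε hε => ?_⟩
      filter_upwards [hxs ε hε, hys ε hε] with i hi hi'
      have := (convex_closedBall (u i) (s + ε)) (x := x) (y := y)
        (by rwa [Metric.mem_closedBall, dist_comm, dist_eq_norm])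
        (by rwa [Metric.mem_closedBall, dist_comm, dist_eq_norm]) ha hb hab
      rwa [Metric.mem_closedBall, dist_comm, dist_eq_norm] at this
    · refine isClosed_of_closure_subset fun x hx => ?_
      refine ⟨closure_minimal (sep_subset _ _) h.isClosed hx, fun ε hε => ?_⟩
      obtain ⟨y, hy, hxy⟩ := Metric.mem_closure_iff.1 hx (ε / 2) (half_pos hε)
      rw [dist_comm, dist_eq_norm] at hxy
      filter_upwards [hy.2 (ε / 2) (half_pos hε)] with i hi
      linarith [norm_sub_le_norm_sub_add_norm_sub (u i) y x]
    · rintro x ⟨hx, hxs⟩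
      refine ⟨h.mapsTo hx, fun ε hε => ?_⟩
      filter_upwards [hxs (ε / 2) (half_pos hε), hfix.eventually_le_const (half_pos hε)] with i hi hi'
      have h1 := norm_sub_le_norm_sub_add_norm_sub (u i) (T (u i)) (T x)
      rw [norm_sub_rev (u i) (T (u i))] at h1
      linarith [h.nonexpansive _ (hu i) x hx]
  obtain ⟨z, hz, hlim⟩ := exists_weak_limit h.isCompact U hu
  refine h.norm_sub_le_of_radius hz fun y hy => ?_
  rw [← hA] at hy
  refine le_of_forall_pos_le_add fun ε hε => ?_
  rw [norm_sub_rev]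
  refine norm_le_of_weak_tendsto (l := (U : Filter ι)) (u := fun i => u i - y) (fun f => ?_)
    (hy.2 ε hε)
  simpa using (hlim f).sub_const (f y)

/-- The Goebel–Karlovitz lemma: almost fixed points of a minimal set are almost at distance the
diameter from any given point. -/
theorem exists_lt_norm_sub (h : IsMinimalInvariant T K) {s : ℝ} (hs : s < Metric.diam K)
    (hs0 : 0 ≤ s) {x₀ : X} (hx₀ : x₀ ∈ K) :
    ∃ δ > 0, ∀ x ∈ K, ‖T x - x‖ ≤ δ → s < ‖x - x₀‖ := by
  by_contra! hcon
  choose u hu using fun n : ℕ => hcon (1 / ((n : ℝ) + 1)) (by positivity)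
  have hlim : Tendsto (fun n => ‖T (u n) - u n‖) (hyperfilter ℕ : Filter ℕ) (𝓝 0) :=
    (squeeze_zero (fun _ => norm_nonneg _) (fun n => (hu n).2.1)
      tendsto_one_div_add_atTop_nhds_zero_nat).mono_left Nat.hyperfilter_le_atTop
  have := h.norm_sub_le_of_approx_fixed (hyperfilter ℕ) (fun n => (hu n).1) hlim hx₀
    (Eventually.of_forall fun n => (hu n).2.2)
  refine hs.not_ge (Metric.diam_le_of_forall_dist_le hs0 fun x hx y hy => ?_)
  rw [dist_eq_norm]
  exact this y hy x hx

theorem norm_sub_le_diam (h : IsMinimalInvariant T K) {x y : X} (hx : x ∈ K) (hy : y ∈ K) :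
    ‖x - y‖ ≤ Metric.diam K := by
  rw [← dist_eq_norm]
  exact Metric.dist_le_diam_of_mem (isBounded_of_isCompact_toWeakSpace h.isCompact) hx hy

theorem diam_pos (h : IsMinimalInvariant T K) (hT : ∀ x ∈ K, T x ≠ x) : 0 < Metric.diam K := by
  obtain ⟨x, hx⟩ := h.nonempty
  exact (norm_pos_iff.2 (sub_ne_zero.2 (hT x hx))).trans_le
    (h.norm_sub_le_diam (h.mapsTo hx) hx)

/-- Contracting `T` towards a point `q` yields a fixed point of the contraction. -/
theorem exists_contraction_fixed [CompleteSpace X] (h : IsMinimalInvariant T K) {q : X}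
    (hq : q ∈ K) {r : ℝ} (hr0 : 0 < r) (hr1 : r ≤ 1) :
    ∃ z ∈ K, z = (1 - r) • T z + r • q := by
  have hm : MapsTo (fun z => (1 - r) • T z + r • q) K K := fun z hz =>
    h.convex (h.mapsTo hz) hq (by linarith) hr0.le (by ring)
  have hc : ContractingWith (Real.toNNReal (1 - r)) (hm.restrict _ K K) := by
    refine ⟨by simpa using hr0, LipschitzWith.of_dist_le_mul ?_⟩
    rintro ⟨x, hx⟩ ⟨y, hy⟩
    have e : (1 - r) • T x + r • q - ((1 - r) • T y + r • q) = (1 - r) • (T x - T y) := by module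
    simp only [Subtype.dist_eq, MapsTo.val_restrict_apply, dist_eq_norm, e, norm_smul,
      Real.coe_toNNReal _ (sub_nonneg.2 hr1), Real.norm_of_nonneg (sub_nonneg.2 hr1)]
    exact mul_le_mul_of_nonneg_left (h.nonexpansive x hx y hy) (by linarith)
  obtain ⟨z, hz, hfix, -⟩ := hc.exists_fixedPoint' h.isClosed.isComplete hm hq (edist_ne_top _ _)
  exact ⟨z, hz, hfix.symm⟩

theorem norm_map_sub_le_of_eq (h : IsMinimalInvariant T K) {q z : X} (hq : q ∈ K) (hz : z ∈ K)
    {r : ℝ} (hr0 : 0 < r) (e : z = (1 - r) • T z + r • q) :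
    ‖T z - z‖ ≤ r * Metric.diam K := by
  have e' : T z - z = r • (T z - q) := by
    nth_rw 2 [e]
    module
  rw [e', norm_smul, Real.norm_of_nonneg hr0.le]
  exact mul_le_mul_of_nonneg_left (h.norm_sub_le_diam (h.mapsTo hz) hq) hr0.le

theorem exists_approx_fixed_seq [CompleteSpace X] (h : IsMinimalInvariant T K) :
    ∃ u : ℕ → X, (∀ n, u n ∈ K) ∧ Tendsto (fun n => ‖T (u n) - u n‖) atTop (𝓝 0) := by
  obtain ⟨q, hq⟩ := h.nonempty
  have key : ∀ n : ℕ, ∃ z ∈ K, ‖T z - z‖ ≤ 1 / ((n : ℝ) + 1) * Metric.diam K := fun n => by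
    have h1 : 0 < 1 / ((n : ℝ) + 1) := by positivity
    have h2 : 1 / ((n : ℝ) + 1) ≤ 1 := by
      rw [div_le_one (by positivity)]
      linarith [n.cast_nonneg (α := ℝ)]
    obtain ⟨z, hz, e⟩ := h.exists_contraction_fixed hq h1 h2
    exact ⟨z, hz, h.norm_map_sub_le_of_eq hq hz h1 e⟩
  choose u hu hfix using key
  refine ⟨u, hu, squeeze_zero (fun _ => norm_nonneg _) hfix ?_⟩
  simpa using tendsto_one_div_add_atTop_nhds_zero_nat.mul_const (Metric.diam K)

/-- Around a minimal set of positive diameter there are almost square pairs. -/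
theorem exists_almost_square [CompleteSpace X] (h : IsMinimalInvariant T K)
    (hd : 0 < Metric.diam K) {η : ℝ} (hη : 0 < η) (hηd : η < Metric.diam K) :
    ∃ a b : X, ‖a‖ ≤ Metric.diam K / 2 ∧ ‖b‖ ≤ Metric.diam K / 2 ∧
      Metric.diam K - 4 * η ≤ ‖a + b‖ ∧ Metric.diam K - 4 * η ≤ ‖a - b‖ := by
  set d := Metric.diam K with hd_def
  let U : Ultrafilter ℕ := hyperfilter ℕ
  obtain ⟨x, hx, hxfix⟩ := h.exists_approx_fixed_seq
  replace hxfix : Tendsto (fun n => ‖T (x n) - x n‖) U (𝓝 0) :=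
    hxfix.mono_left Nat.hyperfilter_le_atTop
  obtain ⟨p, hp, hxp⟩ := exists_weak_limit h.isCompact U hx
  obtain ⟨δ, hδ, hGK⟩ := h.exists_lt_norm_sub (s := d - η) (by linarith) (by linarith) hp
  -- One `r` serves all `n`, since `‖T (w n) - w n‖ ≤ r * d`.
  obtain ⟨r, hr0, hr1, hrδ⟩ : ∃ r : ℝ, 0 < r ∧ r ≤ 1 ∧ r * d ≤ δ := by
    refine ⟨min 1 (δ / d), lt_min one_pos (div_pos hδ hd), min_le_left _ _, ?_⟩
    calc min 1 (δ / d) * d ≤ δ / d * d := by gcongr; exact min_le_right _ _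
      _ = δ := div_mul_cancel₀ _ hd.ne'
  have hq : ∀ n, (1 / 2 : ℝ) • p + (1 / 2 : ℝ) • x n ∈ K := fun n =>
    h.convex hp (hx n) (by norm_num) (by norm_num) (by norm_num)
  choose w hw hweq using fun n => h.exists_contraction_fixed (hq n) hr0 hr1
  have hwp : ∀ n, d - η < ‖w n - p‖ := fun n =>
    hGK _ (hw n) ((h.norm_map_sub_le_of_eq (hq n) (hw n) hr0 (hweq n)).trans hrδ)
  have hww : ∀ n m, ‖w n - w m‖ ≤ d / 2 := fun n m => by
    have e : w n - w m = (1 - r) • (T (w n) - T (w m)) + (r / 2) • (x n - x m) := by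
      nth_rw 1 [hweq n, hweq m]
      module
    have h1 := norm_add_le ((1 - r) • (T (w n) - T (w m))) ((r / 2) • (x n - x m))
    rw [← e, norm_smul, norm_smul, Real.norm_of_nonneg (sub_nonneg.2 hr1),
      Real.norm_of_nonneg (half_pos hr0).le] at h1
    have h2 := mul_le_mul_of_nonneg_left (h.nonexpansive _ (hw n) _ (hw m)) (sub_nonneg.2 hr1)
    have h3 := mul_le_mul_of_nonneg_left (h.norm_sub_le_diam (hx n) (hx m)) (half_pos hr0).le
    refine le_of_mul_le_mul_left (?_ : r * _ ≤ r * _) hr0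
    linarith
  have hwx : ∀ ε > 0, ∀ᶠ n in (U : Filter ℕ), ‖w n - x n‖ ≤ d / 2 + ε := fun ε hε => by
    -- The tolerance is `r * ε` because the estimate is divided by `r` at the end.
    filter_upwards [hxfix.eventually_le_const (mul_pos hr0 hε)] with n hn
    have e : w n - x n = (1 - r) • (T (w n) - T (x n)) + (1 - r) • (T (x n) - x n)
        + (r / 2) • (p - x n) := by
      nth_rw 1 [hweq n]
      module
    have h1 := norm_add₃_le (a := (1 - r) • (T (w n) - T (x n)))
      (b := (1 - r) • (T (x n) - x n)) (c := (r / 2) • (p - x n))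
    rw [← e, norm_smul, norm_smul, norm_smul, Real.norm_of_nonneg (sub_nonneg.2 hr1),
      Real.norm_of_nonneg (half_pos hr0).le] at h1
    have h2 := mul_le_mul_of_nonneg_left (h.nonexpansive _ (hw n) _ (hx n)) (sub_nonneg.2 hr1)
    have h3 := mul_le_mul_of_nonneg_left (h.norm_sub_le_diam hp (hx n)) (half_pos hr0).le
    have h4 : (1 - r) * ‖T (x n) - x n‖ ≤ ‖T (x n) - x n‖ :=
      mul_le_of_le_one_left (norm_nonneg _) (by linarith)
    refine le_of_mul_le_mul_left (?_ : r * _ ≤ r * _) hr0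
    linarith
  obtain ⟨y, -, hwy⟩ := exists_weak_limit h.isCompact U hw
  have hyp : ‖y - p‖ ≤ d / 2 := le_of_forall_pos_le_add fun ε hε =>
    norm_le_of_weak_tendsto (l := (U : Filter ℕ)) (u := fun n => w n - x n)
      (fun f => by simpa using (hwy f).sub (hxp f)) (hwx ε hε)
  have hwy' : ∀ n, ‖w n - y‖ ≤ d / 2 := fun n =>
    norm_le_of_weak_tendsto (l := (U : Filter ℕ)) (u := fun m => w n - w m)
      (fun f => by simpa using (hwy f).const_sub (f (w n))) (Eventually.of_forall fun m => hww n m)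
  choose g hg hgw using fun n => exists_dual_vector'' ℝ (w n - p)
  have hgle : ∀ n v, g n v ≤ ‖v‖ := fun n v =>
    (le_abs_self _).trans (by simpa using (g n).le_of_opNorm_le (hg n) v)
  have hgsum : ∀ n, d - η < g n (w n - y) + g n (y - p) := fun n => by
    rw [← map_add, sub_add_sub_cancel, hgw n]
    exact hwp n
  have hgy : ∀ n, d / 2 - η < g n (y - p) := fun n => by
    linarith [hgsum n, (hgle n (w n - y)).trans (hwy' n)]
  have hgwy : ∀ n, d / 2 - η < g n (w n - y) := fun n => by
    linarith [hgsum n, (hgle n (y - p)).trans hyp]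
  have hweak : ∀ f : StrongDual ℝ X, Tendsto (fun n => f (w n - y)) U (𝓝 0) := fun f => by
    simpa using (hwy f).sub_const (f y)
  obtain ⟨f, hf⟩ := exists_weakStar_limit U hg
  -- Fixing `n` with `f (w n - y) < η` first lets a single `m` make both cross terms `g m (w n - y)`
  -- and `g n (w m - y)` small.
  obtain ⟨n, hn⟩ := ((hweak f).eventually_lt_const hη).exists
  obtain ⟨m, hm1, hm2⟩ := (((hf (w n - y)).eventually_lt_const hn).and
    ((hweak (g n)).eventually_lt_const hη)).exists
  refine ⟨w n - w m, y - p, hww n m, hyp, ?_, ?_⟩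
  · have h1 := hgle n (w n - w m + (y - p))
    rw [map_add, ← sub_sub_sub_cancel_right (w n) (w m) y, map_sub] at h1
    rw [sub_sub_sub_cancel_right] at h1
    linarith [hgy n, hgwy n]
  · have h1 := hgle m (w m - w n + (y - p))
    rw [map_add, ← sub_sub_sub_cancel_right (w m) (w n) y, map_sub] at h1
    rw [sub_sub_sub_cancel_right, ← norm_neg, neg_add, neg_sub, ← sub_eq_add_neg] at h1
    linarith [hgy m, hgwy m]

end IsMinimalInvariant

end MinimalSets

/-! ### From almost square pairs to the James constant -/

section JamesConstant

variable {X : Type*} [NormedAddCommGroup X] [NormedSpace ℝ X]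

theorem norm_sub_inv_norm_smul {a : X} (ha : a ≠ 0) : ‖a - ‖a‖⁻¹ • a‖ = |‖a‖ - 1| := by
  have h : ‖a‖ ≠ 0 := norm_ne_zero_iff.2 ha
  have e : a - ‖a‖⁻¹ • a = (1 - ‖a‖⁻¹) • a := by module
  have e' : ‖a‖ - 1 = (1 - ‖a‖⁻¹) * ‖a‖ := by field_simp
  rw [e, norm_smul, Real.norm_eq_abs, e', abs_mul, abs_norm]

/-- Both norms are at least `1 - ε`, so normalizing moves each vector by at most `ε`, costing `2 *
ε` more. -/
theorem exists_mem_jamesSet {ε : ℝ} (hε : ε < 1) {a b : X} (ha : ‖a‖ ≤ 1) (hb : ‖b‖ ≤ 1)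
    (hadd : 2 - ε ≤ ‖a + b‖) (hsub : 2 - ε ≤ ‖a - b‖) :
    ∃ r ∈ jamesSet X, 2 - 3 * ε ≤ r := by
  have hle := norm_add_le a b
  have ha0 : 0 < ‖a‖ := by linarith
  have hb0 : 0 < ‖b‖ := by linarith
  have ha1 := norm_sub_inv_norm_smul (norm_pos_iff.1 ha0)
  have hb1 := norm_sub_inv_norm_smul (norm_pos_iff.1 hb0)
  rw [abs_of_nonpos (by linarith)] at ha1 hb1
  set a' := ‖a‖⁻¹ • a with ha'
  set b' := ‖b‖⁻¹ • b with hb'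
  refine ⟨_, ⟨a', ?_, b', ?_, rfl⟩, le_min ?_ ?_⟩
  · rw [mem_sphere_zero_iff_norm, ha', norm_smul, norm_inv, norm_norm, inv_mul_cancel₀ ha0.ne']
  · rw [mem_sphere_zero_iff_norm, hb', norm_smul, norm_inv, norm_norm, inv_mul_cancel₀ hb0.ne']
  · have h1 := norm_add₃_le (a := a' + b') (b := a - a') (c := b - b')
    rw [show a' + b' + (a - a') + (b - b') = a + b by abel] at h1
    linarith
  · have h1 := norm_add₃_le (a := a' - b') (b := a - a') (c := -(b - b'))
    rw [norm_neg, show a' - b' + (a - a') + -(b - b') = a - b by abel] at h1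
    linarith

theorem jamesConstant_eq_two_of_almost_square
    (h : ∀ ε > 0, ∃ a b : X, ‖a‖ ≤ 1 ∧ ‖b‖ ≤ 1 ∧ 2 - ε ≤ ‖a + b‖ ∧ 2 - ε ≤ ‖a - b‖) :
    jamesConstant X = 2 := by
  have key : ∀ ε > 0, ε < 1 → ∃ r ∈ jamesSet X, 2 - 3 * ε ≤ r := fun ε hε hε1 => by
    obtain ⟨a, b, ha, hb, h1, h2⟩ := h ε hε
    exact exists_mem_jamesSet hε1 ha hb h1 h2
  obtain ⟨r₀, hr₀, -⟩ := key (1 / 2) (by norm_num) (by norm_num)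
  refine csSup_eq_of_forall_le_of_forall_lt_exists_gt ⟨r₀, hr₀⟩
    (fun r hr => jamesSet_le_two X hr) fun t ht => ?_
  obtain ⟨r, hr, hle⟩ := key (min (1 / 2) ((2 - t) / 6))
    (lt_min (by norm_num) (by linarith)) ((min_le_left _ _).trans_lt (by norm_num))
  exact ⟨r, hr, by linarith [min_le_right (1 / 2 : ℝ) ((2 - t) / 6)]⟩

end JamesConstant

/-- A Banach space without the fixed point property has James constant `2`. Taking limits along
ultrafilters, weak-star compactness of the dual ball (Banach–Alaoglu) suffices here, so that no
sequential compactness is needed. -/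
theorem jamesConstant_eq_two_of_not_hasFPP (X : Type*) [NormedAddCommGroup X] [NormedSpace ℝ X]
    [CompleteSpace X] (hfpp : ¬ HasFPP X) : jamesConstant X = 2 := by
  classical
  simp only [HasFPP, not_forall, not_exists] at hfpp
  obtain ⟨C, hne, hconv, hC, T, hT, hnofix⟩ := hfpp
  let S : X → X := fun x => if hx : x ∈ C then T ⟨x, hx⟩ else x
  have hS : ∀ x (hx : x ∈ C), S x = T ⟨x, hx⟩ := fun x hx => dif_pos hx
  obtain ⟨K, hKC, hK⟩ := exists_isMinimalInvariant (T := S) hne hconv hC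
    (fun x hx => by rw [hS x hx]; exact (T _).2)
    (fun x hx y hy => by rw [hS x hx, hS y hy]; exact hT _ _)
  have hd : 0 < Metric.diam K := hK.diam_pos fun x hx e =>
    hnofix ⟨x, hKC hx⟩ (Subtype.ext (by rw [← hS x (hKC hx), e]))
  set d := Metric.diam K
  refine jamesConstant_eq_two_of_almost_square fun ε hε => ?_
  -- The `1 / 2` ensures `η < d`; the `ε / 8` turns the loss `4 * η`, scaled by `2 / d`, into at
  -- most `ε`.
  obtain ⟨a, b, ha, hb, h1, h2⟩ := hK.exists_almost_square hd
    (η := d * min (1 / 2) (ε / 8)) (by positivity)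
    (mul_lt_of_lt_one_right hd ((min_le_left _ _).trans_lt (by norm_num)))
  have hscale : ∀ v : X, ‖(2 / d) • v‖ = 2 / d * ‖v‖ := fun v => by
    rw [norm_smul, Real.norm_of_nonneg (by positivity)]
  have hball : ∀ v : X, ‖v‖ ≤ d / 2 → ‖(2 / d) • v‖ ≤ 1 := fun v hv => by
    rw [hscale]
    calc 2 / d * ‖v‖ ≤ 2 / d * (d / 2) := by gcongr
      _ = 1 := by field_simp
  have hfar : ∀ v : X, d - 4 * (d * min (1 / 2) (ε / 8)) ≤ ‖v‖ → 2 - ε ≤ ‖(2 / d) • v‖ :=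
    fun v hv => by
    rw [hscale]
    calc 2 - ε ≤ 2 - 8 * min (1 / 2) (ε / 8) := by linarith [min_le_right (1 / 2 : ℝ) (ε / 8)]
      _ = 2 / d * (d - 4 * (d * min (1 / 2) (ε / 8))) := by field_simp; ring
      _ ≤ 2 / d * ‖v‖ := by gcongr
  refine ⟨(2 / d) • a, (2 / d) • b, hball a ha, hball b hb, ?_, ?_⟩
  · rw [← smul_add]
    exact hfar _ h1
  · rw [← smul_sub]
    exact hfar _ h2

theorem mainTheorem1 (X : Type*) [NormedAddCommGroup X] [NormedSpace ℝ X] [CompleteSpace X]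
    (hball : IsSeqCompact (weakStarDualBall X)) (hfpp : ¬ HasFPP X) :
    jamesConstant X = 2 :=
  jamesConstant_eq_two_of_not_hasFPP X hfpp
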